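/- **Conventions.** All algebras are commutative complex Banach algebras with unit. For such an algebra $A$, let $M(A)$ be its character space, that is, the set of nonzero multiplicative linear functionals on $A$ with the relative weak-star topology of $A^*$. Let $\hat a$ be the Gelfand transform of $a\in A$, and let $\operatorname{supp}(a)$ be the closure in $M(A)$ of $\{\phi\in M(A):\hat a(\phi)\ne 0\}$. For $\phi\in M(A)$ put $$I_\phi=\{a\in A:\hat a(\phi)=0\},\qquad J_\phi=\{a\in A:\phi\notin\operatorname{supp}(a)\}.$$ The algebra $A$ is a *Ditkin algebra* if, for every $\phi\in M(A)$ and every $a\in I_\phi$, the element $a$ lies in the norm closure of $aJ_\phi=\{ab:b\in J_\phi\}$. The algebra $A$ is *semisimple* if its Jacobson radical is zero. A *Tomiyama product* of $A$ and $B$ is the completion of the algebraic tensor product $A\otimes B$ with respect to some submultiplicative norm $N$ that is a cross norm, i.e. $N(a\otimes b)=\|a\|\,\|b\|$ for all $a\in A$, $b\in B$, and is not less than the injective tensor product norm, i.e. $$N(u)\ \ge\ \sup\{|(\lambda\otimes\mu)(u)|:\lambda\in A^*,\ \mu\in B^*,\ \|\lambda\|\le1,\ \|\mu\|\le1\}\qquad\text{for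 all } u\in A\otimes B.$$ **Corollary.** Let $A$ and $B$ be nonzero semisimple commutative Banach algebras with unit, and let $C$ be a semisimple Tomiyama product of $A$ and $B$. If $C$ is a Ditkin algebra, then $A$ and $B$ are Ditkin algebras. -/

import Mathlib

open scoped TensorProduct

noncomputable section

section GelfandTheory

variable {A : Type*} [NormedCommRing A] [NormedAlgebra ℂ A] [CompleteSpace A]

/-- The cozero set `{φ ∈ M(A) : â(φ) ≠ 0}` in the character space `M(A)`, which carries the
weak-star topology. -/
def gelfandCoz (a : A) : Set (WeakDual.characterSpace ℂ A) :=
  {φ | WeakDual.gelfandTransform ℂ A a φ ≠ 0}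

/-- The support of `a`: the closure of its cozero set in the character space. -/
def gelfandSupp (a : A) : Set (WeakDual.characterSpace ℂ A) :=
  closure (gelfandCoz a)

/-- The kernel `I_S` of a set `S` of characters: all `a` whose Gelfand transform vanishes
on `S`. -/
def kernelIdeal (S : Set (WeakDual.characterSpace ℂ A)) : Set A :=
  {a | ∀ φ ∈ S, WeakDual.gelfandTransform ℂ A a φ = 0}

/-- The smaller ideal `J_S`: all `a` whose support is disjoint from `S`. -/
def suppIdeal (S : Set (WeakDual.characterSpace ℂ A)) : Set A :=
  {a | gelfandSupp a ∩ S = ∅}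

/-- Ditkin's condition at `φ`: every `a ∈ I_φ` lies in the closure of `a J_φ`. -/
def DitkinConditionAt (φ : WeakDual.characterSpace ℂ A) : Prop :=
  ∀ a ∈ kernelIdeal {φ}, a ∈ closure ((fun b : A => a * b) '' suppIdeal {φ})

variable (A) in
/-- A Ditkin algebra: Ditkin's condition holds at every character. -/
def IsDitkinAlgebra : Prop :=
  ∀ φ : WeakDual.characterSpace ℂ A, DitkinConditionAt φ

end GelfandTheory

/-- Semisimplicity in the sense of Banach algebra theory: the Jacobson radical is zero.
(Mathlib's `IsSemisimpleRing` is a different, much stronger notion.) -/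
def IsJacobsonSemisimple (A : Type*) [CommRing A] : Prop :=
  Ring.jacobson A = ⊥

section TensorNorms

variable {A B : Type*} [NormedCommRing A] [NormedAlgebra ℂ A]
  [NormedCommRing B] [NormedAlgebra ℂ B]

/-- The value `(φ ⊗ ψ)(u)` of a product functional on a tensor, so that
`(φ ⊗ ψ)(a ⊗ b) = φ a * ψ b`. -/
def tensorEval (φ : StrongDual ℂ A) (ψ : StrongDual ℂ B) (u : A ⊗[ℂ] B) : ℂ :=
  TensorProduct.dualDistrib ℂ A B ((φ : Module.Dual ℂ A) ⊗ₜ[ℂ] (ψ : Module.Dual ℂ B)) u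

/-- The injective tensor product norm: the supremum of `|(φ ⊗ ψ)(u)|` over all `φ`, `ψ` in the
closed unit balls of the dual spaces. -/
def injectiveTensorNorm (u : A ⊗[ℂ] B) : ℝ :=
  ⨆ p : Metric.closedBall (0 : StrongDual ℂ A) 1 × Metric.closedBall (0 : StrongDual ℂ B) 1,
    ‖tensorEval (p.1 : StrongDual ℂ A) (p.2 : StrongDual ℂ B) u‖

/-- The supremum that defines the injective tensor product norm is always finite. -/
theorem bddAbove_injectiveTensorNorm (u : A ⊗[ℂ] B) :
    BddAbove (Set.range fun p : Metric.closedBall (0 : StrongDual ℂ A) 1 ×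
      Metric.closedBall (0 : StrongDual ℂ B) 1 =>
        ‖tensorEval (p.1 : StrongDual ℂ A) (p.2 : StrongDual ℂ B) u‖) := by
  induction u with
  | zero => exact ⟨0, by rintro _ ⟨p, rfl⟩; simp [tensorEval]⟩
  | tmul a b =>
    refine ⟨‖a‖ * ‖b‖, ?_⟩
    rintro _ ⟨⟨⟨φ, hφ⟩, ⟨ψ, hψ⟩⟩, rfl⟩
    have h1 := φ.le_of_opNorm_le (mem_closedBall_zero_iff.1 hφ) a
    have h2 := ψ.le_of_opNorm_le (mem_closedBall_zero_iff.1 hψ) b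
    rw [one_mul] at h1 h2
    simpa [tensorEval] using mul_le_mul h1 h2 (norm_nonneg _) (norm_nonneg _)
  | add x y hx hy =>
    obtain ⟨c, hc⟩ := hx
    obtain ⟨d, hd⟩ := hy
    refine ⟨c + d, ?_⟩
    rintro _ ⟨p, rfl⟩
    have h1 := hc ⟨p, rfl⟩
    have h2 := hd ⟨p, rfl⟩
    simp only [tensorEval, map_add] at h1 h2 ⊢
    exact (norm_add_le _ _).trans (add_le_add h1 h2)

/-- A submultiplicative norm on the algebra `A ⊗ B` (this is what `AlgebraNorm` says) which is
a cross norm and is not less than the injective tensor product norm. -/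
structure IsTomiyamaNorm (N : AlgebraNorm ℂ (A ⊗[ℂ] B)) : Prop where
  cross : ∀ (a : A) (b : B), N (a ⊗ₜ[ℂ] b) = ‖a‖ * ‖b‖
  injective_le : ∀ u : A ⊗[ℂ] B, injectiveTensorNorm u ≤ N u

variable (A B) in
/-- `C` is a Tomiyama product of `A` and `B`: it is the completion of the algebra `A ⊗ B` in
some Tomiyama norm `N`, that is, a complete normed algebra with an isometric algebra
homomorphism from `(A ⊗ B, N)` onto a dense subalgebra. -/
def IsTomiyamaProduct (C : Type*) [NormedCommRing C] [NormedAlgebra ℂ C] [CompleteSpace C] :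
    Prop :=
  ∃ N : AlgebraNorm ℂ (A ⊗[ℂ] B), IsTomiyamaNorm N ∧
    ∃ ι : A ⊗[ℂ] B →ₐ[ℂ] C, (∀ u, ‖ι u‖ = N u) ∧ DenseRange ι

end TensorNorms

end

/-!
A Ditkin algebra passes its property on to every image under a continuous surjective unital
homomorphism `S : C → D`. Indeed, composition with `S` is a continuous map `M(D) → M(C)`, so if
the Gelfand transform of `c` vanishes near `φ ∘ S`, then that of `S c` vanishes near `φ`. In other
words `S` maps `J_{φ ∘ S}` into `J_φ`, and applying `S` to approximations `c * b → c` with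
`b ∈ J_{φ ∘ S}` gives Ditkin's condition at `φ` for `S c` (`IsDitkinAlgebra.of_surjective`).

Each factor is such an image of a Tomiyama product. A character `ψ` of `B` gives the slice
homomorphism `a ⊗ b ↦ ψ b • a` from `A ⊗ B` onto `A`. By Hahn–Banach its norm can be tested against
functionals `λ` on `A`, where it becomes the product functional `λ ⊗ ψ`; as the norm of the product
dominates the injective norm, the slice homomorphism is bounded, and it extends to the completion.
The factor `B` is treated in the same way with a character of `A`. Characters exist because the
factors are nonzero.
-/

open scoped TensorProduct

section Ditkin

/-- `c` lies in `J_φ` exactly when its Gelfand transform vanishes on a neighbourhood of `φ`. -/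
theorem mem_suppIdeal_singleton_iff {C : Type*} [NormedCommRing C] [NormedAlgebra ℂ C]
    (φ : WeakDual.characterSpace ℂ C) (c : C) :
    c ∈ suppIdeal {φ} ↔ ∀ᶠ χ in nhds φ, χ c = 0 := by
  have h : c ∈ suppIdeal {φ} ↔ φ ∉ closure (gelfandCoz c) := by
    simp [suppIdeal, gelfandSupp]
  rw [h, mem_closure_iff_frequently, Filter.not_frequently]
  simp [gelfandCoz]

variable {C D : Type*} [NormedCommRing C] [NormedAlgebra ℂ C] [CompleteSpace C]
  [NormedCommRing D] [NormedAlgebra ℂ D] [CompleteSpace D]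

/-- The map `M(D) → M(C)`, `φ ↦ φ ∘ S`, of a homomorphism `S : C → D`. Continuity of `S` is not
assumed: `φ ∘ S`, being multiplicative on a Banach algebra, is continuous in any case. -/
noncomputable def characterComp (S : C →ₐ[ℂ] D) :
    C(WeakDual.characterSpace ℂ D, WeakDual.characterSpace ℂ C) where
  toFun φ := WeakDual.CharacterSpace.equivAlgHom.symm
    ((WeakDual.CharacterSpace.equivAlgHom φ).comp S)
  continuous_toFun := Continuous.subtype_mk (WeakDual.continuous_of_continuous_eval fun a =>
    map_continuous (WeakDual.gelfandTransform ℂ D (S a))) _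

theorem characterComp_apply (S : C →ₐ[ℂ] D) (φ : WeakDual.characterSpace ℂ D) (c : C) :
    characterComp S φ c = φ (S c) :=
  rfl

/-- The Ditkin property passes to images under continuous surjective homomorphisms. -/
theorem IsDitkinAlgebra.of_surjective (hC : IsDitkinAlgebra C) (S : C →ₐ[ℂ] D)
    (hcont : Continuous S) (hS : Function.Surjective S) : IsDitkinAlgebra D := by
  intro φ d hd
  obtain ⟨c, rfl⟩ := hS d
  have hc : c ∈ kernelIdeal {characterComp S φ} := by
    simpa [kernelIdeal, characterComp_apply] using hd
  refine map_mem_closure hcont (hC _ c hc) ?_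
  rintro _ ⟨b, hb, rfl⟩
  refine ⟨S b, ?_, (map_mul S c b).symm⟩
  rw [mem_suppIdeal_singleton_iff] at hb ⊢
  exact (characterComp S).continuous.continuousAt.eventually hb

/-- A bounded homomorphism from a dense subalgebra of `C` onto `D` extends to `C`, so that `D`
inherits the Ditkin property from `C`. -/
theorem IsDitkinAlgebra.of_denseRange {R : Type*} [Ring R] [Algebra ℂ R]
    (hC : IsDitkinAlgebra C) (ι : R →ₐ[ℂ] C) (hι : DenseRange ι) (f : R →ₐ[ℂ] D)
    (hf : Function.Surjective f) (hbound : ∃ K : ℝ, ∀ u, ‖f u‖ ≤ K * ‖ι u‖) :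
    IsDitkinAlgebra D := by
  let T : C →L[ℂ] D := f.toLinearMap.extendOfNorm ι.toLinearMap
  have hT : ∀ u, T (ι u) = f u := f.toLinearMap.extendOfNorm_eq hι hbound
  have hone : T 1 = 1 := by rw [← map_one ι, hT, map_one]
  have hmul : ∀ x y, T (x * y) = T x * T y := fun x y =>
    hι.induction_on₂ (p := fun x y => T (x * y) = T x * T y)
      (isClosed_eq (by fun_prop) (by fun_prop))
      (fun u v => by rw [← map_mul, hT, hT, hT, map_mul]) x y
  refine hC.of_surjective (AlgHom.ofLinearMap T hone hmul) T.continuous fun d => ?_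
  obtain ⟨u, rfl⟩ := hf d
  exact ⟨ι u, hT u⟩

end Ditkin

section Slice

variable {A B : Type*} [NormedCommRing A] [NormedAlgebra ℂ A]
  [NormedCommRing B] [NormedAlgebra ℂ B]

theorem tensorEval_tmul (φ : StrongDual ℂ A) (ψ : StrongDual ℂ B) (a : A) (b : B) :
    tensorEval φ ψ (a ⊗ₜ[ℂ] b) = φ a * ψ b := by
  simp [tensorEval]

theorem tensorEval_smul_smul (r s : ℂ) (φ : StrongDual ℂ A) (ψ : StrongDual ℂ B)
    (u : A ⊗[ℂ] B) : tensorEval (r • φ) (s • ψ) u = r * s * tensorEval φ ψ u := by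
  simp [tensorEval, ← TensorProduct.smul_tmul', mul_assoc, mul_left_comm]

theorem exists_norm_smul_eq {E : Type*} [NormedAddCommGroup E] [NormedSpace ℂ E] (x : E) :
    ∃ y ∈ Metric.closedBall (0 : E) 1, (‖x‖ : ℂ) • y = x := by
  rcases eq_or_ne x 0 with rfl | hx
  · exact ⟨0, by simp⟩
  · have h : (‖x‖ : ℂ) ≠ 0 := by simpa using hx
    exact ⟨(‖x‖ : ℂ)⁻¹ • x, by simp [norm_smul, hx], smul_inv_smul₀ h x⟩

theorem norm_tensorEval_le (φ : StrongDual ℂ A) (ψ : StrongDual ℂ B) (u : A ⊗[ℂ] B) :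
    ‖tensorEval φ ψ u‖ ≤ ‖φ‖ * ‖ψ‖ * injectiveTensorNorm u := by
  obtain ⟨φ₁, hφ₁, hφ⟩ := exists_norm_smul_eq φ
  obtain ⟨ψ₁, hψ₁, hψ⟩ := exists_norm_smul_eq ψ
  have h : ‖tensorEval φ₁ ψ₁ u‖ ≤ injectiveTensorNorm u :=
    le_ciSup (bddAbove_injectiveTensorNorm u) (⟨φ₁, hφ₁⟩, ⟨ψ₁, hψ₁⟩)
  calc ‖tensorEval φ ψ u‖ = ‖tensorEval ((‖φ‖ : ℂ) • φ₁) ((‖ψ‖ : ℂ) • ψ₁) u‖ := by rw [hφ, hψ]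
    _ = ‖φ‖ * ‖ψ‖ * ‖tensorEval φ₁ ψ₁ u‖ := by simp [tensorEval_smul_smul]
    _ ≤ ‖φ‖ * ‖ψ‖ * injectiveTensorNorm u := by gcongr

theorem injectiveTensorNorm_nonneg (u : A ⊗[ℂ] B) : 0 ≤ injectiveTensorNorm u :=
  Real.iSup_nonneg fun _ => norm_nonneg _

/-- The slice homomorphism `A ⊗ B → A`, `a ⊗ b ↦ ψ b • a`, of a character `ψ` of `B`. -/
noncomputable def sliceLeft (ψ : WeakDual.characterSpace ℂ B) : A ⊗[ℂ] B →ₐ[ℂ] A :=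
  Algebra.TensorProduct.lift (AlgHom.id ℂ A)
    ((Algebra.ofId ℂ A).comp (WeakDual.CharacterSpace.toAlgHom ψ)) fun _ _ => Commute.all _ _

/-- The slice homomorphism `A ⊗ B → B`, `a ⊗ b ↦ φ a • b`, of a character `φ` of `A`. -/
noncomputable def sliceRight (φ : WeakDual.characterSpace ℂ A) : A ⊗[ℂ] B →ₐ[ℂ] B :=
  Algebra.TensorProduct.lift ((Algebra.ofId ℂ B).comp (WeakDual.CharacterSpace.toAlgHom φ))
    (AlgHom.id ℂ B) fun _ _ => Commute.all _ _

theorem sliceLeft_tmul (ψ : WeakDual.characterSpace ℂ B) (a : A) (b : B) :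
    sliceLeft ψ (a ⊗ₜ[ℂ] b) = ψ b • a := by
  simp [sliceLeft, Algebra.ofId_apply, Algebra.smul_def, mul_comm]

theorem sliceRight_tmul (φ : WeakDual.characterSpace ℂ A) (a : A) (b : B) :
    sliceRight φ (a ⊗ₜ[ℂ] b) = φ a • b := by
  simp [sliceRight, Algebra.ofId_apply, Algebra.smul_def]

theorem sliceLeft_surjective (ψ : WeakDual.characterSpace ℂ B) :
    Function.Surjective (sliceLeft (A := A) ψ) :=
  fun a => ⟨a ⊗ₜ 1, by simp [sliceLeft_tmul]⟩

theorem sliceRight_surjective (φ : WeakDual.characterSpace ℂ A) :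
    Function.Surjective (sliceRight (B := B) φ) :=
  fun b => ⟨1 ⊗ₜ b, by simp [sliceRight_tmul]⟩

theorem apply_sliceLeft (g : StrongDual ℂ A) (ψ : WeakDual.characterSpace ℂ B) (u : A ⊗[ℂ] B) :
    g (sliceLeft ψ u) = tensorEval g (WeakDual.toStrongDual (ψ : WeakDual ℂ B)) u := by
  induction u with
  | zero => simp [tensorEval]
  | tmul a b =>
    rw [sliceLeft_tmul, tensorEval_tmul, map_smul, smul_eq_mul, mul_comm]
    rfl
  | add x y hx hy => rw [map_add, map_add, hx, hy]; exact (map_add _ x y).symm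

theorem apply_sliceRight (φ : WeakDual.characterSpace ℂ A) (g : StrongDual ℂ B) (u : A ⊗[ℂ] B) :
    g (sliceRight φ u) = tensorEval (WeakDual.toStrongDual (φ : WeakDual ℂ A)) g u := by
  induction u with
  | zero => simp [tensorEval]
  | tmul a b =>
    rw [sliceRight_tmul, tensorEval_tmul, map_smul, smul_eq_mul]
    rfl
  | add x y hx hy => rw [map_add, map_add, hx, hy]; exact (map_add _ x y).symm

theorem norm_sliceLeft_le (ψ : WeakDual.characterSpace ℂ B) (u : A ⊗[ℂ] B) :
    ‖sliceLeft ψ u‖ ≤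
      ‖WeakDual.toStrongDual (ψ : WeakDual ℂ B)‖ * injectiveTensorNorm u := by
  obtain ⟨g, hg, hgu⟩ := exists_dual_vector'' ℂ (sliceLeft ψ u)
  calc ‖sliceLeft ψ u‖
      = ‖tensorEval g (WeakDual.toStrongDual (ψ : WeakDual ℂ B)) u‖ := by
        rw [← apply_sliceLeft, hgu]; simp
    _ ≤ ‖g‖ * ‖WeakDual.toStrongDual (ψ : WeakDual ℂ B)‖ * injectiveTensorNorm u :=
        norm_tensorEval_le _ _ _
    _ ≤ 1 * ‖WeakDual.toStrongDual (ψ : WeakDual ℂ B)‖ * injectiveTensorNorm u := by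
        have := injectiveTensorNorm_nonneg u
        gcongr
    _ = _ := by rw [one_mul]

theorem norm_sliceRight_le (φ : WeakDual.characterSpace ℂ A) (u : A ⊗[ℂ] B) :
    ‖sliceRight φ u‖ ≤
      ‖WeakDual.toStrongDual (φ : WeakDual ℂ A)‖ * injectiveTensorNorm u := by
  obtain ⟨g, hg, hgu⟩ := exists_dual_vector'' ℂ (sliceRight φ u)
  calc ‖sliceRight φ u‖
      = ‖tensorEval (WeakDual.toStrongDual (φ : WeakDual ℂ A)) g u‖ := by
        rw [← apply_sliceRight, hgu]; simp
    _ ≤ ‖WeakDual.toStrongDual (φ : WeakDual ℂ A)‖ * ‖g‖ * injectiveTensorNorm u :=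
        norm_tensorEval_le _ _ _
    _ ≤ ‖WeakDual.toStrongDual (φ : WeakDual ℂ A)‖ * 1 * injectiveTensorNorm u := by
        have := injectiveTensorNorm_nonneg u
        gcongr
    _ = _ := by rw [mul_one]

end Slice

theorem corollary2p2
    (A : Type*) [NormedCommRing A] [NormedAlgebra ℂ A] [CompleteSpace A] [Nontrivial A]
    (B : Type*) [NormedCommRing B] [NormedAlgebra ℂ B] [CompleteSpace B] [Nontrivial B]
    (C : Type*) [NormedCommRing C] [NormedAlgebra ℂ C] [CompleteSpace C]
    (hA : IsJacobsonSemisimple A) (hB : IsJacobsonSemisimple B)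
    (hC : IsJacobsonSemisimple C) (hABC : IsTomiyamaProduct A B C)
    (hD : IsDitkinAlgebra C) :
    IsDitkinAlgebra A ∧ IsDitkinAlgebra B := by
  obtain ⟨N, hN, ι, hι, hdense⟩ := hABC
  obtain ⟨φ⟩ : Nonempty (WeakDual.characterSpace ℂ A) := inferInstance
  obtain ⟨ψ⟩ : Nonempty (WeakDual.characterSpace ℂ B) := inferInstance
  have hle : ∀ u, injectiveTensorNorm u ≤ ‖ι u‖ := fun u => (hN.injective_le u).trans_eq (hι u).symm
  exact ⟨hD.of_denseRange ι hdense (sliceLeft ψ) (sliceLeft_surjective ψ)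
      ⟨_, fun u => (norm_sliceLeft_le ψ u).trans
        (mul_le_mul_of_nonneg_left (hle u) (norm_nonneg _))⟩,
    hD.of_denseRange ι hdense (sliceRight φ) (sliceRight_surjective φ)
      ⟨_, fun u => (norm_sliceRight_le φ u).trans
        (mul_le_mul_of_nonneg_left (hle u) (norm_nonneg _))⟩⟩
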